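/- Let $\alpha>-1$ be real. For $k\ge 0$ let $$p_k(x)=\sqrt2\,(-1)^k\sum_{j=0}^k\frac{(-1)^j\,\Gamma(2\alpha+j+k+2)}{j!\,\Gamma(\alpha+j+1)\,\Gamma(2\alpha+j+2)\,(k-j)!}\,x^j,$$ $$q_k(x)=\sqrt2\,(-1)^k(\alpha+k+1)\sum_{j=0}^k\frac{(-1)^j\,\Gamma(2\alpha+j+k+2)}{j!\,\Gamma(\alpha+j+2)\,\Gamma(2\alpha+j+2)\,(k-j)!}\,x^j.$$ These are the Cauchy–Laguerre biorthogonal polynomials: $p_k$ and $q_k$ have exact degree $k$ and the same positive leading coefficient, denoted $S_k$, and for all $k,l\ge0$ (with absolute convergence) $$\int_0^\infty\!\!\int_0^\infty p_k(x)\,q_l(y)\,\frac{x^{\alpha}y^{\alpha+1}e^{-x-y}}{x+y}\,dx\,dy=\delta_{k,l}.$$ Let $$P_k(x)=\int_0^\infty\frac{v^{\alpha}e^{-v}}{x-v}\,p_k(v)\,dv,\qquad Q_k(y)=\int_0^\infty\frac{w^{\alpha+1}e^{-w}}{y-w}\,q_k(w)\,dw$$ be their Cauchy transforms. The integral $P_k(x)$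 converges absolutely for $x\in D_P=\mathbb C\setminus[0,\infty)$ (and also for $x=0$, which is then included in $D_P$, if $\alpha>0$), and $Q_k(y)$ converges absolutely for $y\in D_Q=\mathbb C\setminus(0,\infty)$. For an integer $m\ge1$ and for sequences $a=(a_k)_{k\ge0}$, $b=(b_k)_{k\ge0}$ of functions, write $$A_m[a](x)=\frac{S_{m-1}}{S_m}a_{m-1}(x)-\frac{S_m}{S_{m+1}}a_{m+1}(x)+x\,a_m(x)-\Big(\alpha+m+1-\frac{S_m}{S_{m+1}}+\frac{S_{m-1}}{S_m}\Big)a_m(x),$$ $$B_m[b](y)=\frac{S_{m-1}}{S_m}b_{m-1}(y)-\frac{S_m}{S_{m+1}}b_{m+1}(y)+y\,b_m(y)-\Big(\alpha+m+1+\frac{S_m}{S_{m+1}}-\frac{S_{m-1}}{S_m}\Big)b_m(y).$$ Then for every $m\ge1$ the following Christoffel–Darboux formulas hold. (i) For all $x,y\in\mathbb C$, $$(x+y)\sum_{k=0}^{m-1}p_k(x)q_k(y)=\frac{A_m[p](x)\,B_m[q](y)}{2(\alpha+m+1)}+\frac{S_{m-1}}{S_m}\big(p_m(x)q_{m-1}(y)+p_{m-1}(x)q_m(y)\big).$$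 (ii) For all $x\in D_P$, $y\in\mathbb C$, $$(x+y)\sum_{k=0}^{m-1}P_k(x)q_k(y)=\frac{A_m[P](x)\,B_m[q](y)}{2(\alpha+m+1)}+\frac{S_{m-1}}{S_m}\big(P_m(x)q_{m-1}(y)+P_{m-1}(x)q_m(y)\big).$$ (iii) For all $x\in\mathbb C$, $y\in D_Q$, $$(x+y)\sum_{k=0}^{m-1}p_k(x)Q_k(y)=\frac{A_m[p](x)\,B_m[Q](y)}{2(\alpha+m+1)}+\frac{S_{m-1}}{S_m}\big(p_m(x)Q_{m-1}(y)+p_{m-1}(x)Q_m(y)\big).$$ (iv) For all $x\in D_P$, $y\in D_Q$, $$(x+y)\sum_{k=0}^{m-1}P_k(x)Q_k(y)=-1+\frac{A_m[P](x)\,B_m[Q](y)}{2(\alpha+m+1)}+\frac{S_{m-1}}{S_m}\big(P_m(x)Q_{m-1}(y)+P_{m-1}(x)Q_m(y)\big).$$ -/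

import Mathlib

open Polynomial MeasureTheory

noncomputable section

namespace CauchyLaguerre

/-- The Cauchy-Laguerre polynomial `p_k`, in its explicit normalization. -/
def p (α : ℝ) (k : ℕ) : ℝ[X] :=
  ∑ j ∈ Finset.range (k + 1),
    C (√2 * (-1) ^ k * ((-1) ^ j * Real.Gamma (2 * α + j + k + 2) /
        ((j.factorial : ℝ) * Real.Gamma (α + j + 1) * Real.Gamma (2 * α + j + 2) *
          ((k - j).factorial : ℝ)))) * X ^ j

/-- The Cauchy-Laguerre polynomial `q_k`, in its explicit normalization. -/
def q (α : ℝ) (k : ℕ) : ℝ[X] :=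
  ∑ j ∈ Finset.range (k + 1),
    C (√2 * (-1) ^ k * (α + k + 1) * ((-1) ^ j * Real.Gamma (2 * α + j + k + 2) /
        ((j.factorial : ℝ) * Real.Gamma (α + j + 2) * Real.Gamma (2 * α + j + 2) *
          ((k - j).factorial : ℝ)))) * X ^ j

/-- The weight `W(x, y) = x ^ α * y ^ (α + 1) * exp (-x - y) / (x + y)`. -/
def W (α x y : ℝ) : ℝ :=
  x ^ α * y ^ (α + 1) * Real.exp (-x - y) / (x + y)

/-- `f_k` and `g_k` are polynomials of exact degree `k` with the same positive leading coefficient,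
and they are biorthonormal for the weight `W` on the open first quadrant
(all double integrals converge absolutely). -/
structure IsBiorthonormal (α : ℝ) (f g : ℕ → ℝ[X]) : Prop where
  natDegree_left : ∀ k, (f k).natDegree = k
  natDegree_right : ∀ k, (g k).natDegree = k
  leadingCoeff_pos : ∀ k, 0 < (f k).leadingCoeff
  leadingCoeff_eq : ∀ k, (g k).leadingCoeff = (f k).leadingCoeff
  integrable : ∀ k l, IntegrableOn
    (fun z : ℝ × ℝ => (f k).eval z.1 * (g l).eval z.2 * W α z.1 z.2)
    (Set.Ioi (0 : ℝ) ×ˢ Set.Ioi (0 : ℝ))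
  integral_eq : ∀ k l,
    ∫ z in Set.Ioi (0 : ℝ) ×ˢ Set.Ioi (0 : ℝ),
      (f k).eval z.1 * (g l).eval z.2 * W α z.1 z.2 = if k = l then 1 else 0

/-- The highest order coefficient `S_k` of `p_k`. -/
def S (α : ℝ) (k : ℕ) : ℝ := (p α k).leadingCoeff

/-- The integrand `v ^ β * exp (-v) * f v / (z - v)` of a Cauchy transform. -/
def cauchyIntegrand (β : ℝ) (f : ℝ[X]) (z : ℂ) (v : ℝ) : ℂ :=
  ((v ^ β * Real.exp (-v) : ℝ) : ℂ) / (z - (v : ℂ)) * ((f.eval v : ℝ) : ℂ)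

/-- The Cauchy transform of `f` against the Laguerre weight `v ^ β * exp (-v)` on `(0, ∞)`. -/
def cauchyTransform (β : ℝ) (f : ℝ[X]) (z : ℂ) : ℂ :=
  ∫ v in Set.Ioi (0 : ℝ), cauchyIntegrand β f z v

/-- The points at which Cauchy transforms against `v ^ β * exp (-v)` converge: the plane cut along
`[0, ∞)`, together with the end point `0` of the cut when `0 < β`. -/
def cauchyDomain (β : ℝ) : Set ℂ :=
  {z | (∀ v : ℝ, 0 ≤ v → z ≠ (v : ℂ)) ∨ (z = 0 ∧ 0 < β)}

/-- `P_k`, the Cauchy transform of `p_k`. -/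
def P (α : ℝ) (k : ℕ) (z : ℂ) : ℂ := cauchyTransform α (p α k) z

/-- `Q_k`, the Cauchy transform of `q_k`. -/
def Q (α : ℝ) (k : ℕ) (z : ℂ) : ℂ := cauchyTransform (α + 1) (q α k) z

/-- The first bracket, formed from the values `a k` at `x` of the members `k = m-1, m, m+1` of a
sequence of functions. -/
def bracketLeft (α : ℝ) (m : ℕ) (a : ℕ → ℂ) (x : ℂ) : ℂ :=
  (S α (m - 1) : ℂ) / S α m * a (m - 1) - (S α m : ℂ) / S α (m + 1) * a (m + 1) + x * a m
    - ((α : ℂ) + m + 1 - (S α m : ℂ) / S α (m + 1) + (S α (m - 1) : ℂ) / S α m) * a m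

/-- The second bracket, formed from the values `b k` at `y` of the members `k = m-1, m, m+1` of a
sequence of functions. -/
def bracketRight (α : ℝ) (m : ℕ) (b : ℕ → ℂ) (y : ℂ) : ℂ :=
  (S α (m - 1) : ℂ) / S α m * b (m - 1) - (S α m : ℂ) / S α (m + 1) * b (m + 1) + y * b m
    - ((α : ℂ) + m + 1 + (S α m : ℂ) / S α (m + 1) - (S α (m - 1) : ℂ) / S α m) * b m

/-- The summation-free Christoffel-Darboux expression. -/
def christoffelDarboux (α : ℝ) (m : ℕ) (a b : ℕ → ℂ) (x y : ℂ) : ℂ :=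
  1 / (2 * ((α : ℂ) + m + 1)) * (bracketLeft α m a x * bracketRight α m b y)
    + (S α (m - 1) : ℂ) / S α m * (a m * b (m - 1) + a (m - 1) * b m)

end CauchyLaguerre

end

/-! Put β = 2α + 2. Up to constants, `p α k` and `q α k` have the same coefficients, those of a
Jacobi polynomial on [0, 1], divided by Γ(α+j+1) and Γ(α+j+2) respectively. Multiplication by x
shifts j and, through the Gamma quotients, becomes a factor linear in j. It is not tridiagonal:
besides the neighbours m-1, m, m+1 it produces a tail over all l < m (`X_mul_p`, `X_mul_q`). The
tails are Σ 2(α+l+1) p_l and 2(α+m+1) Σ q_l, hence of rank-one type.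

Therefore (x+y) Σ p_k q_k telescopes to the product of Σ 2(α+l+1) p_l and Σ q_l plus a boundary term
(`mul_sum_eq_of_recurrence`). Solving the recurrences for the tails turns these sums into the
three-term brackets A_m and B_m / (2(α+m+1)).

The argument uses only the recurrences, so it applies to any linear functional of p and q. For the
Cauchy transform, z L(f) = L(Xf) + ∫ wf, and the moments ∫ wf are √2 for p_m and √2(α+m+1) for q_m.
They add constants u = √2 and v = √2/2 to the tails; the telescoped sum starts at -uv, which is the
-1 in (iv) and is zero in the other cases.

Biorthonormality: the bimoments are Γ(a+1)Γ(b+1)/(a+b+1), by a Laplace representation of 1/(x+y).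
The Gamma factors cancel against the coefficients and leave Jacobi orthogonality, i.e. sums against
1/(β+i+j), which finite differences evaluate. -/

noncomputable section

namespace CauchyLaguerre

/-! ### Coefficients and recurrences -/

/-- The coefficients of the Jacobi polynomials on `[0, 1]` for the weight `t ^ (β - 1)`, in the
normalization common to `p` and `q`. -/
def jacobiCoeff (β : ℝ) (k j : ℕ) : ℝ :=
  if j ≤ k then (-1) ^ k * ((-1) ^ j * Real.Gamma (β + j + k) /
    ((j.factorial : ℝ) * Real.Gamma (β + j) * ((k - j).factorial : ℝ))) else 0

lemma jacobiCoeff_of_lt {β : ℝ} {k j : ℕ} (h : k < j) : jacobiCoeff β k j = 0 := by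
  simp [jacobiCoeff, h]

lemma jacobiCoeff_add (β : ℝ) (j n : ℕ) : jacobiCoeff β (j + n) j =
    (-1) ^ n * Real.Gamma (β + (2 * j + n)) /
      ((j.factorial : ℝ) * Real.Gamma (β + j) * (n.factorial : ℝ)) := by
  have h : β + j + ((j + n : ℕ) : ℝ) = β + (2 * j + n) := by push_cast; ring
  have h2 : ((-1 : ℝ) ^ j) * (-1) ^ j = 1 := by rw [← mul_pow]; simp
  rw [jacobiCoeff, if_pos (Nat.le_add_right _ _), Nat.add_sub_cancel_left, h, pow_add]
  linear_combination ((-1) ^ n * Real.Gamma (β + (2 * j + n)) /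
      ((j.factorial : ℝ) * Real.Gamma (β + j) * (n.factorial : ℝ))) * h2

lemma coeff_p (α : ℝ) (k j : ℕ) : (p α k).coeff j =
    √2 * jacobiCoeff (2 * α + 2) k j / Real.Gamma (α + j + 1) := by
  have h : ∀ i : ℕ, 2 * α + i + k + 2 = 2 * α + 2 + i + k := fun i => by ring
  have h' : ∀ i : ℕ, 2 * α + i + 2 = 2 * α + 2 + i := fun i => by ring
  simp only [p, finsetSum_coeff, coeff_C_mul, coeff_X_pow, mul_ite, mul_one, mul_zero,
    Finset.sum_ite_eq, Finset.mem_range, Nat.lt_succ_iff, jacobiCoeff, h, h']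
  split_ifs
  · ring
  · simp

lemma coeff_q (α : ℝ) (k j : ℕ) : (q α k).coeff j =
    √2 * (α + k + 1) * jacobiCoeff (2 * α + 2) k j / Real.Gamma (α + j + 2) := by
  have h : ∀ i : ℕ, 2 * α + i + k + 2 = 2 * α + 2 + i + k := fun i => by ring
  have h' : ∀ i : ℕ, 2 * α + i + 2 = 2 * α + 2 + i := fun i => by ring
  simp only [q, finsetSum_coeff, coeff_C_mul, coeff_X_pow, mul_ite, mul_one, mul_zero,
    Finset.sum_ite_eq, Finset.mem_range, Nat.lt_succ_iff, jacobiCoeff, h, h']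
  split_ifs
  · ring
  · simp

/-- A common factor of the Jacobi coefficients of index `(m + 1, j)` and its neighbours. -/
def jacobiFactor (β : ℝ) (j n : ℕ) : ℝ :=
  (-1) ^ n * Real.Gamma (β + (2 * j + n) - 2) /
    ((j.factorial : ℝ) * Real.Gamma (β + j) * (n.factorial : ℝ))

section neighbours

variable {β : ℝ} {m j n : ℕ}

lemma Gamma_succ {x y : ℝ} (hx : 0 < x) (h : y = x + 1) :
    Real.Gamma y = x * Real.Gamma x := by
  rw [h, Real.Gamma_add_one hx.ne']

/-- With n = m + 2 - j, the entries of rows m, m+1, m+2 in column j, and the left neighbour in row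
m+1, are polynomial multiples of one `jacobiFactor`. Linear relations among them thus reduce to
polynomial identities. -/
lemma jacobiCoeff_mid (hβ : 0 < β) (h : m + 2 = j + n) :
    jacobiCoeff β (m + 1) j = -jacobiFactor β j n * ((β + j + m) * n) := by
  rcases n with _ | n
  · rw [jacobiCoeff_of_lt (by lia)]; simp
  · have hm : m + 1 = j + n := by lia
    have hc : (m : ℝ) = j + n - 1 := by
      have : (m : ℝ) + 1 = j + n := by exact_mod_cast hm
      linarith
    have hp : 0 < β + (2 * j + n) - 1 := by
      have : (0 : ℝ) ≤ m := m.cast_nonneg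
      have : (0 : ℝ) ≤ j := j.cast_nonneg
      linarith
    rw [hm, jacobiCoeff_add, jacobiFactor, Gamma_succ hp (by ring), Nat.factorial_succ, hc]
    have := (Real.Gamma_pos_of_pos (show 0 < β + j by positivity)).ne'
    push_cast
    rw [show β + (2 * (j : ℝ) + (n + 1)) - 2 = β + (2 * j + n) - 1 by ring]
    field_simp
    ring

lemma jacobiCoeff_low (hβ : 0 < β) (h : m + 2 = j + n) :
    jacobiCoeff β m j = jacobiFactor β j n * (n * (n - 1)) := by
  -- For n = 0 and n = 1 the entry lies outside row m, and the factor n (n - 1) vanishes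
  -- accordingly.
  rcases n with _ | _ | n
  · rw [jacobiCoeff_of_lt (by lia)]; simp
  · rw [jacobiCoeff_of_lt (by lia)]; simp
  · obtain rfl : m = j + n := by lia
    rw [jacobiCoeff_add, jacobiFactor, Nat.factorial_succ, Nat.factorial_succ]
    have := (Real.Gamma_pos_of_pos (show 0 < β + j by positivity)).ne'
    push_cast
    rw [show β + (2 * (j : ℝ) + (n + 1 + 1)) - 2 = β + (2 * j + n) by ring]
    field_simp
    ring

lemma jacobiCoeff_high (hβ : 0 < β) (h : m + 2 = j + n) :
    jacobiCoeff β (m + 2) j = jacobiFactor β j n * ((β + j + m) * (β + j + m + 1)) := by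
  have hc : (m : ℝ) = j + n - 2 := by
    have : (m : ℝ) + 2 = j + n := by exact_mod_cast h
    linarith
  have hp : 0 < β + (2 * j + n) - 2 := by
    have : (0 : ℝ) ≤ m := m.cast_nonneg
    have : (0 : ℝ) ≤ j := j.cast_nonneg
    linarith
  rw [h, jacobiCoeff_add, jacobiFactor,
    Gamma_succ (x := β + (2 * j + n) - 2 + 1) (by linarith) (by ring), Gamma_succ hp rfl, hc]
  ring

lemma jacobiCoeff_left (hβ : 0 < β) (h : m + 2 = j + 1 + n) :
    jacobiCoeff β (m + 1) j = jacobiFactor β (j + 1) n * ((j + 1) * (β + j)) := by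
  obtain hm : m + 1 = j + n := by lia
  rw [hm, jacobiCoeff_add, jacobiFactor, Nat.factorial_succ]
  have hp : 0 < β + j := by positivity
  have := (Real.Gamma_pos_of_pos hp).ne'
  push_cast
  rw [Gamma_succ (y := β + (j + 1 : ℝ)) hp (by ring),
    show β + (2 * ((j : ℝ) + 1) + n) - 2 = β + (2 * j + n) by ring]
  field_simp

end neighbours

/-- The quotient `S_{m-1} / S_m` of consecutive leading coefficients, with value `0` at `m = 0`. -/
def ratio (β : ℝ) (m : ℕ) : ℝ := m * (β + m - 1) / (2 * (β + 2 * m - 1))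

lemma ratio_zero (β : ℝ) : ratio β 0 = 0 := by simp [ratio]

/-- Telescoping in m. This is the source of the long tail: the factor j - m produced by
multiplication by x unfolds into all earlier rows. -/
lemma sum_jacobiCoeff {β : ℝ} (hβ : 0 < β) (m j : ℕ) :
    ∑ l ∈ Finset.range m, (β + 2 * l) * jacobiCoeff β l j = (j - m) * jacobiCoeff β m j := by
  induction m with
  | zero =>
    rcases j with _ | j
    · simp
    · simp [jacobiCoeff_of_lt]
  | succ m ih =>
    rw [Finset.sum_range_succ, ih]
    rcases lt_or_ge (m + 2) j with h | h
    · rw [jacobiCoeff_of_lt (by lia), jacobiCoeff_of_lt (by lia)]; simp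
    · obtain ⟨n, hn⟩ := Nat.exists_eq_add_of_le h
      rw [jacobiCoeff_mid hβ hn, jacobiCoeff_low hβ hn]
      have hc : (m : ℝ) = j + n - 2 := by
        have : (m : ℝ) + 2 = j + n := by exact_mod_cast hn
        linarith
      push_cast
      rw [hc]
      ring

/-- The coefficient `j - 1` of row `m`, with value `0` at `j = 0`. -/
def jacobiShift (β : ℝ) (m j : ℕ) : ℝ := if j = 0 then 0 else jacobiCoeff β m (j - 1)

lemma jacobiShift_eq {β : ℝ} (hβ : 0 < β) {m j n : ℕ} (h : m + 2 = j + n) :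
    jacobiShift β (m + 1) j = jacobiFactor β j n * (j * (β + j - 1)) := by
  rcases j with _ | j
  · simp [jacobiShift]
  · simp only [jacobiShift, Nat.succ_ne_zero, if_false, Nat.add_sub_cancel]
    rw [jacobiCoeff_left hβ h]
    push_cast
    ring

lemma jacobiShift_of_lt {β : ℝ} {m j : ℕ} (h : m + 1 < j) : jacobiShift β m j = 0 := by
  rw [jacobiShift, if_neg (by lia), jacobiCoeff_of_lt (by lia)]

lemma jacobiCoeff_zero_zero {β : ℝ} (hβ : 0 < β) : jacobiCoeff β 0 0 = 1 := by
  have := (Real.Gamma_pos_of_pos hβ).ne'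
  simp [jacobiCoeff, this]

lemma jacobiCoeff_one_zero {β : ℝ} (hβ : 0 < β) : jacobiCoeff β 1 0 = -β := by
  have := (Real.Gamma_pos_of_pos hβ).ne'
  simp [jacobiCoeff, Real.Gamma_add_one hβ.ne', this]

lemma jacobiCoeff_one_one {β : ℝ} (hβ : 0 < β) : jacobiCoeff β 1 1 = β + 1 := by
  have := (Real.Gamma_pos_of_pos hβ).ne'
  simp [jacobiCoeff, Real.Gamma_add_one hβ.ne', Real.Gamma_add_one (show β + 1 ≠ 0 by positivity)]
  field_simp

lemma jacobi_recurrence {α : ℝ} (hα : -1 < α) (m j : ℕ) (β : ℝ) (hβ : β = 2 * α + 2) :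
    (α + j) * jacobiShift β m j = (j - m) * jacobiCoeff β m j
      - ratio β m * jacobiCoeff β (m - 1) j + ratio β (m + 1) * jacobiCoeff β (m + 1) j
      + (α + m + 1 - ratio β (m + 1) + ratio β m) * jacobiCoeff β m j ∧
    (α + m + 1) * (α + j + 1) * jacobiShift β m j = (α + m + 1) * (j - m) * jacobiCoeff β m j
      - ratio β m * ((α + m) * jacobiCoeff β (m - 1) j)
      + ratio β (m + 1) * ((α + m + 2) * jacobiCoeff β (m + 1) j)
      + (α + m + 1 + ratio β (m + 1) - ratio β m) * ((α + m + 1) * jacobiCoeff β m j) := by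
  have hβ0 : 0 < β := by linarith
  obtain rfl : α = β / 2 - 1 := by linarith
  rcases lt_or_ge (m + 1) j with h | h
  · rw [jacobiShift_of_lt h, jacobiCoeff_of_lt (show m < j by lia),
      jacobiCoeff_of_lt (show m - 1 < j by lia), jacobiCoeff_of_lt h]
    simp
  -- The common-factor formulas need a row below the middle one. At m = 0 there is none; the
  -- truncated index m - 1 is harmless because `ratio β 0 = 0`.
  rcases m with _ | m
  · have h1 : ratio β (0 + 1) = β / (2 * (β + 1)) := by
      rw [ratio]; push_cast; ring
    have h2 : β + 1 ≠ 0 := by positivity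
    rw [ratio_zero, h1]
    obtain rfl | rfl : j = 0 ∨ j = 1 := by lia
    · simp only [jacobiShift, if_true, jacobiCoeff_zero_zero hβ0, zero_add,
        jacobiCoeff_one_zero hβ0]
      push_cast
      constructor <;> field_simp <;> ring
    · simp only [jacobiShift, one_ne_zero, if_false, Nat.sub_self, jacobiCoeff_zero_zero hβ0,
        jacobiCoeff_one_one hβ0, zero_add, jacobiCoeff_of_lt (show 0 < 1 by lia)]
      push_cast
      constructor <;> field_simp <;> ring
  · obtain ⟨n, hn⟩ := Nat.exists_eq_add_of_le h
    have hn' : m + 2 = j + n := by lia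
    rw [jacobiShift_eq hβ0 hn', jacobiCoeff_mid hβ0 hn', Nat.add_sub_cancel,
      jacobiCoeff_low hβ0 hn', show m + 1 + 1 = m + 2 by lia, jacobiCoeff_high hβ0 hn', ratio, ratio]
    have hc : (n : ℝ) = m + 2 - j := by
      have : (m : ℝ) + 2 = j + n := by exact_mod_cast hn'
      linarith
    have hm : (0 : ℝ) ≤ m := m.cast_nonneg
    have h1 : β + 2 * (m + 1) - 1 ≠ 0 := by nlinarith
    have h2 : β + 2 * (m + 2) - 1 ≠ 0 := by nlinarith
    push_cast
    rw [hc]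
    constructor <;> field_simp <;> ring

/-- The shift lowers the Gamma argument by one; restoring it by Γ(s+1) = sΓ(s) gives the factor α +
j. -/
lemma coeff_X_mul_p {α : ℝ} (hα : -1 < α) (k j : ℕ) : (X * p α k).coeff j =
    √2 * ((α + j) * jacobiShift (2 * α + 2) k j) / Real.Gamma (α + j + 1) := by
  rcases j with _ | j
  · simp [jacobiShift]
  · have hp : 0 < α + j + 1 := by
      have : (0 : ℝ) ≤ j := j.cast_nonneg
      linarith
    rw [coeff_X_mul, coeff_p, jacobiShift, if_neg (by lia), Nat.add_sub_cancel,
      Gamma_succ (y := α + (j + 1 : ℕ) + 1) hp (by push_cast; ring)]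
    have := (Real.Gamma_pos_of_pos hp).ne'
    have := hp.ne'
    push_cast
    field_simp
    ring

lemma coeff_X_mul_q {α : ℝ} (hα : -1 < α) (k j : ℕ) : (X * q α k).coeff j =
    √2 * ((α + k + 1) * (α + j + 1) * jacobiShift (2 * α + 2) k j) / Real.Gamma (α + j + 2) := by
  rcases j with _ | j
  · simp [jacobiShift]
  · have hp : 0 < α + j + 2 := by
      have : (0 : ℝ) ≤ j := j.cast_nonneg
      linarith
    rw [coeff_X_mul, coeff_q, jacobiShift, if_neg (by lia), Nat.add_sub_cancel,
      Gamma_succ (y := α + (j + 1 : ℕ) + 2) hp (by push_cast; ring)]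
    have := (Real.Gamma_pos_of_pos hp).ne'
    have := hp.ne'
    push_cast
    field_simp
    ring

lemma X_mul_p {α : ℝ} (hα : -1 < α) (m : ℕ) :
    X * p α m = ∑ l ∈ Finset.range m, C (2 * (α + l + 1)) * p α l
      - C (ratio (2 * α + 2) m) * p α (m - 1) + C (ratio (2 * α + 2) (m + 1)) * p α (m + 1)
      + C (α + m + 1 - ratio (2 * α + 2) (m + 1) + ratio (2 * α + 2) m) * p α m := by
  ext j
  have h := (jacobi_recurrence hα m j _ rfl).1
  rw [← sum_jacobiCoeff (by linarith)] at h
  rw [coeff_X_mul_p hα, h]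
  simp only [coeff_add, coeff_sub, finsetSum_coeff, coeff_C_mul, coeff_p]
  have hs : ∑ l ∈ Finset.range m, 2 * (α + l + 1) *
        (√2 * jacobiCoeff (2 * α + 2) l j / Real.Gamma (α + j + 1)) =
      √2 / Real.Gamma (α + j + 1) *
        ∑ l ∈ Finset.range m, (2 * α + 2 + 2 * l) * jacobiCoeff (2 * α + 2) l j := by
    rw [Finset.mul_sum]
    exact Finset.sum_congr rfl fun l _ => by ring
  rw [hs]
  ring

lemma X_mul_q {α : ℝ} (hα : -1 < α) (m : ℕ) :
    X * q α m = C (2 * (α + m + 1)) * ∑ l ∈ Finset.range m, q α l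
      - C (ratio (2 * α + 2) m) * q α (m - 1) + C (ratio (2 * α + 2) (m + 1)) * q α (m + 1)
      + C (α + m + 1 + ratio (2 * α + 2) (m + 1) - ratio (2 * α + 2) m) * q α m := by
  ext j
  have h := (jacobi_recurrence hα m j _ rfl).2
  rw [mul_assoc (α + m + 1) _ (jacobiCoeff _ m j), ← sum_jacobiCoeff (by linarith)] at h
  rw [coeff_X_mul_q hα, h]
  simp only [coeff_add, coeff_sub, finsetSum_coeff, coeff_C_mul, coeff_q]
  have hs : ∑ l ∈ Finset.range m,
        (√2 * (α + l + 1) * jacobiCoeff (2 * α + 2) l j / Real.Gamma (α + j + 2)) =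
      √2 / 2 / Real.Gamma (α + j + 2) *
        ∑ l ∈ Finset.range m, (2 * α + 2 + 2 * l) * jacobiCoeff (2 * α + 2) l j := by
    rw [Finset.mul_sum]
    exact Finset.sum_congr rfl fun l _ => by ring
  rw [hs]
  -- The factor α + (m - 1) + 1 of `q α (m - 1)` equals α + m only for m ≥ 1; at m = 0 its
  -- multiplier `ratio` is zero.
  rcases m with _ | m
  · rw [ratio_zero]
    push_cast
    ring
  · rw [Nat.add_sub_cancel]
    push_cast
    ring

/-! ### Degrees and leading coefficients -/

lemma coeff_p_pos {α : ℝ} (hα : -1 < α) (k : ℕ) : 0 < (p α k).coeff k := by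
  have hk : (0 : ℝ) ≤ k := k.cast_nonneg
  have h := jacobiCoeff_add (2 * α + 2) k 0
  simp only [add_zero] at h
  rw [coeff_p, h]
  have h1 := Real.Gamma_pos_of_pos (show 0 < α + k + 1 by linarith)
  have h2 := Real.Gamma_pos_of_pos (show 0 < 2 * α + 2 + k by linarith)
  have h3 := Real.Gamma_pos_of_pos (show 0 < 2 * α + 2 + (2 * k + (0 : ℕ)) by push_cast; linarith)
  positivity

lemma coeff_q_self {α : ℝ} (hα : -1 < α) (k : ℕ) : (q α k).coeff k = (p α k).coeff k := by
  have hp : 0 < α + k + 1 := by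
    have : (0 : ℝ) ≤ k := k.cast_nonneg
    linarith
  rw [coeff_q, coeff_p, Gamma_succ (y := α + k + 2) hp (by ring)]
  have := (Real.Gamma_pos_of_pos hp).ne'
  field_simp

lemma natDegree_p {α : ℝ} (hα : -1 < α) (k : ℕ) : (p α k).natDegree = k := by
  refine natDegree_eq_of_le_of_coeff_ne_zero ?_ (coeff_p_pos hα k).ne'
  rw [natDegree_le_iff_coeff_eq_zero]
  intro N hN
  simp [coeff_p, jacobiCoeff_of_lt hN]

lemma natDegree_q {α : ℝ} (hα : -1 < α) (k : ℕ) : (q α k).natDegree = k := by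
  refine natDegree_eq_of_le_of_coeff_ne_zero ?_ (by rw [coeff_q_self hα]; exact (coeff_p_pos hα k).ne')
  rw [natDegree_le_iff_coeff_eq_zero]
  intro N hN
  simp [coeff_q, jacobiCoeff_of_lt hN]

lemma S_eq {α : ℝ} (hα : -1 < α) (k : ℕ) : S α k = (p α k).coeff k := by
  rw [S, leadingCoeff, natDegree_p hα]

/-- Compare the coefficients of x^(m+1) in `X_mul_p`: on the right only the `p α (m + 1)` term
reaches that degree. -/
lemma S_div_S {α : ℝ} (hα : -1 < α) (m : ℕ) :
    S α m / S α (m + 1) = ratio (2 * α + 2) (m + 1) := by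
  have h := congrArg (fun f => coeff f (m + 1)) (X_mul_p hα m)
  have hd : ∀ i ≤ m, (p α i).coeff (m + 1) = 0 := fun i hi =>
    coeff_eq_zero_of_natDegree_lt (by rw [natDegree_p hα]; lia)
  simp only [coeff_X_mul, coeff_add, coeff_sub, finsetSum_coeff, coeff_C_mul] at h
  rw [Finset.sum_eq_zero fun l hl => by rw [hd l (Finset.mem_range.1 hl).le, mul_zero],
    hd (m - 1) (by lia), hd m le_rfl] at h
  rw [S_eq hα, S_eq hα, div_eq_iff (coeff_p_pos hα _).ne', h]
  ring

/-! ### The summation-free form -/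

/-- Sequences that satisfy inhomogeneous versions of the recurrences of `p` and `q` satisfy a
Christoffel-Darboux formula. -/
lemma mul_sum_eq_of_recurrence (α : ℂ) (s : ℕ → ℂ) (hs : s 0 = 0) (a b : ℕ → ℂ) (x y u v : ℂ)
    (ha : ∀ m, x * a m = (∑ l ∈ Finset.range m, 2 * (α + l + 1) * a l + u)
      - s m * a (m - 1) + s (m + 1) * a (m + 1) + (α + m + 1 - s (m + 1) + s m) * a m)
    (hb : ∀ m, y * b m = 2 * (α + m + 1) * (∑ l ∈ Finset.range m, b l + v)
      - s m * b (m - 1) + s (m + 1) * b (m + 1) + (α + m + 1 + s (m + 1) - s m) * b m) (m : ℕ) :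
    (x + y) * ∑ k ∈ Finset.range m, a k * b k =
      (∑ l ∈ Finset.range m, 2 * (α + l + 1) * a l + u) * (∑ l ∈ Finset.range m, b l + v) - u * v
        + s m * (a m * b (m - 1) + a (m - 1) * b m) := by
  induction m with
  | zero => simp [hs]
  | succ m ih =>
    rw [Finset.sum_range_succ, Finset.sum_range_succ, Finset.sum_range_succ, mul_add, ih,
      Nat.add_sub_cancel]
    -- The two diagonal coefficients add up to 2(α+m+1), the cross term needed to complete the
    -- product of the enlarged tails; the s-terms telescope.
    linear_combination b m * ha m + a m * hb m

/-- Each bracket is its recurrence solved for the tail, so the product of tails is free of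
summation. -/
lemma christoffelDarboux_of_recurrence {α : ℝ} (hα : -1 < α) (a b : ℕ → ℂ) (x y u v : ℂ)
    (ha : ∀ m : ℕ, x * a m = (∑ l ∈ Finset.range m, 2 * ((α : ℂ) + l + 1) * a l + u)
      - ratio (2 * α + 2) m * a (m - 1) + ratio (2 * α + 2) (m + 1) * a (m + 1)
      + ((α : ℂ) + m + 1 - ratio (2 * α + 2) (m + 1) + ratio (2 * α + 2) m) * a m)
    (hb : ∀ m : ℕ, y * b m = 2 * ((α : ℂ) + m + 1) * (∑ l ∈ Finset.range m, b l + v)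
      - ratio (2 * α + 2) m * b (m - 1) + ratio (2 * α + 2) (m + 1) * b (m + 1)
      + ((α : ℂ) + m + 1 + ratio (2 * α + 2) (m + 1) - ratio (2 * α + 2) m) * b m)
    {m : ℕ} (hm : 1 ≤ m) :
    (x + y) * ∑ k ∈ Finset.range m, a k * b k = -(u * v) + christoffelDarboux α m a b x y := by
  rw [mul_sum_eq_of_recurrence α (fun k => (ratio (2 * α + 2) k : ℂ)) (by simp [ratio_zero])
    a b x y u v ha hb m]
  have h1 : (S α m : ℂ) / S α (m + 1) = ratio (2 * α + 2) (m + 1) := by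
    rw [← Complex.ofReal_div, S_div_S hα]
  have h2 : (S α (m - 1) : ℂ) / S α m = ratio (2 * α + 2) m := by
    obtain ⟨n, rfl⟩ := Nat.exists_eq_add_of_le' hm
    rw [Nat.add_sub_cancel, ← Complex.ofReal_div, S_div_S hα]
  have hne : (α : ℂ) + m + 1 ≠ 0 := by
    have : (0 : ℝ) ≤ m := m.cast_nonneg
    have h : α + m + 1 ≠ 0 := by linarith
    exact_mod_cast h
  have hl : bracketLeft α m a x = ∑ l ∈ Finset.range m, 2 * ((α : ℂ) + l + 1) * a l + u := by
    rw [bracketLeft, h1, h2]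
    linear_combination ha m
  have hr : bracketRight α m b y = 2 * ((α : ℂ) + m + 1) * (∑ l ∈ Finset.range m, b l + v) := by
    rw [bracketRight, h1, h2]
    linear_combination hb m
  rw [christoffelDarboux, hl, hr, h2]
  field_simp
  ring

/-- The recurrence of `p` passes to linear functionals, up to the defect of `L (X * f) = x * L f`. -/
lemma map_p_recurrence {α : ℝ} (hα : -1 < α) (L : ℝ[X] →ₗ[ℝ] ℂ) (x u : ℂ)
    (hL : ∀ m, x * L (p α m) = L (X * p α m) + u) (m : ℕ) :
    x * L (p α m) = (∑ l ∈ Finset.range m, 2 * ((α : ℂ) + l + 1) * L (p α l) + u)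
      - ratio (2 * α + 2) m * L (p α (m - 1)) + ratio (2 * α + 2) (m + 1) * L (p α (m + 1))
      + ((α : ℂ) + m + 1 - ratio (2 * α + 2) (m + 1) + ratio (2 * α + 2) m) * L (p α m) := by
  rw [hL, X_mul_p hα]
  simp only [← smul_eq_C_mul]
  simp only [map_add, map_sub, map_sum, map_smul, Complex.real_smul]
  push_cast
  ring

/-- The defect is taken proportional to α + m + 1 so that it joins the tail as a constant v
independent of m. -/
lemma map_q_recurrence {α : ℝ} (hα : -1 < α) (L : ℝ[X] →ₗ[ℝ] ℂ) (y v : ℂ)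
    (hL : ∀ m : ℕ, y * L (q α m) = L (X * q α m) + 2 * ((α : ℂ) + m + 1) * v) (m : ℕ) :
    y * L (q α m) = 2 * ((α : ℂ) + m + 1) * (∑ l ∈ Finset.range m, L (q α l) + v)
      - ratio (2 * α + 2) m * L (q α (m - 1)) + ratio (2 * α + 2) (m + 1) * L (q α (m + 1))
      + ((α : ℂ) + m + 1 + ratio (2 * α + 2) (m + 1) - ratio (2 * α + 2) m) * L (q α m) := by
  rw [hL, X_mul_q hα]
  simp only [← smul_eq_C_mul]
  simp only [map_add, map_sub, map_sum, map_smul, Complex.real_smul]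
  push_cast
  ring

/-! ### Cauchy transforms -/

lemma integrableOn_rpow_mul_exp {a r : ℝ} (ha : -1 < a) (hr : 0 < r) :
    IntegrableOn (fun v : ℝ => v ^ a * Real.exp (-(r * v))) (Set.Ioi 0) := by
  have h := integrableOn_rpow_mul_exp_neg_mul_rpow ha one_pos hr
  simpa only [Real.rpow_one, neg_mul] using h

lemma integral_rpow_mul_exp {a r : ℝ} (ha : -1 < a) (hr : 0 < r) :
    ∫ v in Set.Ioi (0 : ℝ), v ^ a * Real.exp (-(r * v)) =
      (1 / r) ^ (a + 1) * Real.Gamma (a + 1) := by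
  rw [← Real.integral_rpow_mul_exp_neg_mul_Ioi (by linarith) hr, add_sub_cancel_right]

lemma weight_mul_eval {β v : ℝ} (f : ℝ[X]) (hv : 0 < v) :
    v ^ β * Real.exp (-v) * f.eval v = ∑ i ∈ Finset.range (f.natDegree + 1),
      f.coeff i * (v ^ (β + i) * Real.exp (-(1 * v))) := by
  rw [eval_eq_sum_range, Finset.mul_sum]
  refine Finset.sum_congr rfl fun i _ => ?_
  rw [Real.rpow_add_natCast hv.ne', one_mul]
  ring

lemma integrableOn_weight_mul_eval {β : ℝ} (hβ : -1 < β) (f : ℝ[X]) :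
    IntegrableOn (fun v : ℝ => v ^ β * Real.exp (-v) * f.eval v) (Set.Ioi 0) := by
  refine IntegrableOn.congr_fun ?_ (fun v hv => (weight_mul_eval f hv).symm) measurableSet_Ioi
  refine integrable_finsetSum _ fun i _ => (integrableOn_rpow_mul_exp ?_ one_pos).const_mul _
  have : (0 : ℝ) ≤ i := i.cast_nonneg
  linarith

lemma integral_weight_mul_eval {β : ℝ} (hβ : -1 < β) (f : ℝ[X]) :
    ∫ v in Set.Ioi (0 : ℝ), v ^ β * Real.exp (-v) * f.eval v =
      ∑ i ∈ Finset.range (f.natDegree + 1), f.coeff i * Real.Gamma (β + i + 1) := by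
  have hi : ∀ i : ℕ, -1 < β + i := fun i => by
    have : (0 : ℝ) ≤ i := i.cast_nonneg
    linarith
  rw [setIntegral_congr_fun measurableSet_Ioi fun v hv => weight_mul_eval f hv,
    integral_finsetSum _ fun i _ => (integrableOn_rpow_mul_exp (hi i) one_pos).const_mul _]
  refine Finset.sum_congr rfl fun i _ => ?_
  rw [integral_const_mul, integral_rpow_mul_exp (hi i) one_pos]
  simp

lemma measurable_cauchyIntegrand (β : ℝ) (f : ℝ[X]) (z : ℂ) :
    Measurable (cauchyIntegrand β f z) := by
  have h1 : Measurable fun v : ℝ => v ^ β := measurable_id.pow_const β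
  have h2 : Measurable fun v : ℝ => f.eval v := f.continuous.measurable
  unfold cauchyIntegrand
  fun_prop

lemma norm_cauchyIntegrand (β v : ℝ) (f : ℝ[X]) (z : ℂ) :
    ‖cauchyIntegrand β f z v‖ = ‖v ^ β * Real.exp (-v) * f.eval v‖ / ‖z - v‖ := by
  rw [cauchyIntegrand, norm_mul, norm_div, Complex.norm_real, Complex.norm_real,
    norm_mul _ (eval _ _)]
  ring

lemma exists_pos_le_norm_sub {z : ℂ} (hz : ∀ v : ℝ, 0 ≤ v → z ≠ (v : ℂ)) :
    ∃ c > 0, ∀ v : ℝ, 0 ≤ v → c ≤ ‖z - v‖ := by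
  have hc : IsClosed (Complex.ofReal '' Set.Ici 0) :=
    Complex.isometry_ofReal.isClosedEmbedding.isClosedMap _ isClosed_Ici
  have hn : (Complex.ofReal '' Set.Ici 0).Nonempty := ⟨0, 0, by simp⟩
  have hz' : z ∉ Complex.ofReal '' Set.Ici 0 := by
    rintro ⟨v, hv, rfl⟩
    exact hz v hv rfl
  refine ⟨_, (hc.notMem_iff_infDist_pos hn).1 hz', fun v hv => ?_⟩
  rw [← dist_eq_norm]
  exact Metric.infDist_le_dist_of_mem ⟨v, hv, rfl⟩

lemma integrableOn_cauchyIntegrand {β : ℝ} (hβ : -1 < β) (f : ℝ[X]) {z : ℂ}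
    (hz : z ∈ cauchyDomain β) :
    IntegrableOn (cauchyIntegrand β f z) (Set.Ioi 0) := by
  rcases hz with hz | ⟨rfl, hβ0⟩
  · obtain ⟨c, hc, hle⟩ := exists_pos_le_norm_sub hz
    refine Integrable.mono' ((integrableOn_weight_mul_eval hβ f).norm.div_const c)
      (measurable_cauchyIntegrand β f z).aestronglyMeasurable ?_
    filter_upwards [ae_restrict_mem measurableSet_Ioi] with v hv
    rw [norm_cauchyIntegrand]
    gcongr
    exact hle v (le_of_lt hv)
  -- At z = 0 the kernel 1/|v| lowers the exponent to β - 1, which still exceeds -1.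
  · refine Integrable.mono' (integrableOn_weight_mul_eval (β := β - 1) (by linarith) f).norm
      (measurable_cauchyIntegrand β f 0).aestronglyMeasurable ?_
    filter_upwards [ae_restrict_mem measurableSet_Ioi] with v hv
    have hv' : (0 : ℝ) < v := hv
    rw [norm_cauchyIntegrand, zero_sub, norm_neg, Complex.norm_real,
      Real.rpow_sub_one hv'.ne', ← norm_div]
    apply le_of_eq
    congr 1
    ring

/-- The Cauchy transform as a linear functional on polynomials. -/
def cauchyLinear {β : ℝ} (hβ : -1 < β) {z : ℂ} (hz : z ∈ cauchyDomain β) : ℝ[X] →ₗ[ℝ] ℂ where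
  toFun f := cauchyTransform β f z
  map_add' f g := by
    rw [cauchyTransform, cauchyTransform, cauchyTransform, ← integral_add
      (integrableOn_cauchyIntegrand hβ f hz) (integrableOn_cauchyIntegrand hβ g hz)]
    refine integral_congr_ae (Filter.Eventually.of_forall fun v => ?_)
    simp only [cauchyIntegrand, eval_add]
    push_cast
    ring
  map_smul' r f := by
    rw [cauchyTransform, cauchyTransform, RingHom.id_apply, ← integral_smul]
    refine integral_congr_ae (Filter.Eventually.of_forall fun v => ?_)
    simp only [cauchyIntegrand, eval_smul, smul_eq_mul, Complex.real_smul]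
    push_cast
    ring

/-- Integrate z/(z - v) = v/(z - v) + 1 against the weight times f. -/
lemma mul_cauchyLinear {β : ℝ} (hβ : -1 < β) {z : ℂ} (hz : z ∈ cauchyDomain β) (f : ℝ[X]) :
    z * cauchyLinear hβ hz f = cauchyLinear hβ hz (X * f) +
      ((∫ v in Set.Ioi (0 : ℝ), v ^ β * Real.exp (-v) * f.eval v : ℝ) : ℂ) := by
  change z * cauchyTransform β f z = cauchyTransform β (X * f) z + _
  have hw : IntegrableOn (fun v : ℝ => ((v ^ β * Real.exp (-v) * f.eval v : ℝ) : ℂ))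
      (Set.Ioi 0) := (integrableOn_weight_mul_eval hβ f).ofReal
  rw [cauchyTransform, cauchyTransform, ← integral_complex_ofReal, ← integral_const_mul,
    ← integral_add (integrableOn_cauchyIntegrand hβ (X * f) hz) hw]
  refine setIntegral_congr_fun measurableSet_Ioi fun v hv => ?_
  have hv' : (0 : ℝ) < v := hv
  have hne : z - v ≠ 0 := by
    rw [sub_ne_zero]
    rcases hz with hz | ⟨rfl, -⟩
    · exact hz v hv'.le
    · exact_mod_cast hv'.ne
  simp only [cauchyIntegrand, eval_mul, eval_X]
  push_cast
  field_simp
  ring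

/-! ### Bimoments of the weight -/

/-- Since e^{-(x+y)}/(x+y) = ∫_1^∞ e^{-s(x+y)} ds, the bimoment separates at fixed s into two Gamma
integrals, of product ΓΓ s^{-(a+b+2)}. Integrability over s > 1 is exactly a + b + 1 > 0. -/
lemma integrable_laplace_kernel {a b : ℝ} (ha : -1 < a) (hb : -1 < b) (hab : 0 < a + b + 1) :
    Integrable (Function.uncurry fun (s : ℝ) (z : ℝ × ℝ) =>
        (z.1 ^ a * Real.exp (-(s * z.1))) * (z.2 ^ b * Real.exp (-(s * z.2))))
      ((volume.restrict (Set.Ioi 1)).prod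
        ((volume.restrict (Set.Ioi 0)).prod (volume.restrict (Set.Ioi 0)))) ∧
    ∫ s in Set.Ioi (1 : ℝ), ∫ z : ℝ × ℝ,
        (z.1 ^ a * Real.exp (-(s * z.1))) * (z.2 ^ b * Real.exp (-(s * z.2)))
        ∂((volume.restrict (Set.Ioi 0)).prod (volume.restrict (Set.Ioi 0))) =
      Real.Gamma (a + 1) * Real.Gamma (b + 1) / (a + b + 1) := by
  have hval : ∀ s ∈ Set.Ioi (1 : ℝ), ∫ z : ℝ × ℝ,
        (z.1 ^ a * Real.exp (-(s * z.1))) * (z.2 ^ b * Real.exp (-(s * z.2)))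
        ∂((volume.restrict (Set.Ioi 0)).prod (volume.restrict (Set.Ioi 0))) =
      Real.Gamma (a + 1) * Real.Gamma (b + 1) * s ^ (-(a + b + 2)) := by
    intro s hs
    have hs0 : 0 < s := one_pos.trans hs
    rw [integral_prod_mul (fun v : ℝ => v ^ a * Real.exp (-(s * v)))
      (fun v : ℝ => v ^ b * Real.exp (-(s * v))), integral_rpow_mul_exp ha hs0,
      integral_rpow_mul_exp hb hs0, one_div, Real.inv_rpow hs0.le, Real.inv_rpow hs0.le,
      ← Real.rpow_neg hs0.le, ← Real.rpow_neg hs0.le,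
      show -(a + b + 2) = -(a + 1) + -(b + 1) by ring, Real.rpow_add hs0]
    ring
  have hlt : -(a + b + 2) < -1 := by linarith
  constructor
  · have hmeas : Measurable (Function.uncurry fun (s : ℝ) (z : ℝ × ℝ) =>
        (z.1 ^ a * Real.exp (-(s * z.1))) * (z.2 ^ b * Real.exp (-(s * z.2)))) := by
      unfold Function.uncurry
      fun_prop
    rw [integrable_prod_iff hmeas.aestronglyMeasurable]
    constructor
    · filter_upwards [ae_restrict_mem measurableSet_Ioi] with s hs
      have hs0 : 0 < s := one_pos.trans hs
      exact (integrableOn_rpow_mul_exp ha hs0).mul_prod (integrableOn_rpow_mul_exp hb hs0)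
    · refine ((integrableOn_Ioi_rpow_of_lt hlt one_pos).const_mul
        (Real.Gamma (a + 1) * Real.Gamma (b + 1))).congr ?_
      filter_upwards [ae_restrict_mem measurableSet_Ioi] with s hs
      rw [← hval s hs, Measure.prod_restrict]
      refine setIntegral_congr_fun (measurableSet_Ioi.prod measurableSet_Ioi) fun z hz => ?_
      have h1 : 0 < z.1 := hz.1
      have h2 : 0 < z.2 := hz.2
      exact (Real.norm_of_nonneg (by positivity)).symm
  · rw [setIntegral_congr_fun measurableSet_Ioi hval, integral_const_mul,
      integral_Ioi_rpow_of_lt hlt one_pos, Real.one_rpow]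
    rw [show -(a + b + 2) + 1 = -(a + b + 1) by ring, neg_div_neg_eq]
    ring

lemma integral_laplace_kernel {a b x y : ℝ} (hx : 0 < x) (hy : 0 < y) :
    ∫ s in Set.Ioi (1 : ℝ), (x ^ a * Real.exp (-(s * x))) * (y ^ b * Real.exp (-(s * y))) =
      x ^ a * y ^ b * Real.exp (-x - y) / (x + y) := by
  have h : ∀ s : ℝ, (x ^ a * Real.exp (-(s * x))) * (y ^ b * Real.exp (-(s * y))) =
      x ^ a * y ^ b * Real.exp (-(x + y) * s) := fun s => by
    rw [show -(x + y) * s = -(s * x) + -(s * y) by ring, Real.exp_add]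
    ring
  simp_rw [h]
  rw [integral_const_mul, integral_exp_mul_Ioi (by linarith), mul_one, neg_div_neg_eq, neg_add']
  ring

lemma bimoment {a b : ℝ} (ha : -1 < a) (hb : -1 < b) (hab : 0 < a + b + 1) :
    IntegrableOn (fun z : ℝ × ℝ => z.1 ^ a * z.2 ^ b * Real.exp (-z.1 - z.2) / (z.1 + z.2))
      (Set.Ioi (0 : ℝ) ×ˢ Set.Ioi (0 : ℝ)) ∧
    ∫ z in Set.Ioi (0 : ℝ) ×ˢ Set.Ioi (0 : ℝ),
        z.1 ^ a * z.2 ^ b * Real.exp (-z.1 - z.2) / (z.1 + z.2) =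
      Real.Gamma (a + 1) * Real.Gamma (b + 1) / (a + b + 1) := by
  obtain ⟨hint, hval⟩ := integrable_laplace_kernel ha hb hab
  have hm : MeasurableSet (Set.Ioi (0 : ℝ) ×ˢ Set.Ioi (0 : ℝ)) :=
    measurableSet_Ioi.prod measurableSet_Ioi
  have hk : Set.EqOn (fun z : ℝ × ℝ => ∫ s in Set.Ioi (1 : ℝ),
      (z.1 ^ a * Real.exp (-(s * z.1))) * (z.2 ^ b * Real.exp (-(s * z.2))))
      (fun z => z.1 ^ a * z.2 ^ b * Real.exp (-z.1 - z.2) / (z.1 + z.2))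
      (Set.Ioi (0 : ℝ) ×ˢ Set.Ioi (0 : ℝ)) := fun z hz => integral_laplace_kernel hz.1 hz.2
  -- Fubini: performing the s-integral first recovers the kernel 1/(x+y).
  rw [integral_integral_swap hint] at hval
  have hI := hint.integral_prod_right
  rw [Measure.prod_restrict] at hI hval
  exact ⟨(integrableOn_congr_fun hk hm).1 hI, by
    rw [← setIntegral_congr_fun hm hk]; exact hval⟩

lemma eval_mul_eval_mul_W {α : ℝ} (f g : ℝ[X]) {z : ℝ × ℝ}
    (hz : z ∈ Set.Ioi (0 : ℝ) ×ˢ Set.Ioi (0 : ℝ)) :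
    f.eval z.1 * g.eval z.2 * W α z.1 z.2 =
      ∑ i ∈ Finset.range (f.natDegree + 1), ∑ j ∈ Finset.range (g.natDegree + 1),
        f.coeff i * g.coeff j *
          (z.1 ^ (α + i) * z.2 ^ (α + 1 + j) * Real.exp (-z.1 - z.2) / (z.1 + z.2)) := by
  have h1 : z.1 ≠ 0 := ne_of_gt hz.1
  have h2 : z.2 ≠ 0 := ne_of_gt hz.2
  rw [eval_eq_sum_range, eval_eq_sum_range, Finset.sum_mul_sum, Finset.sum_mul]
  refine Finset.sum_congr rfl fun i _ => ?_
  rw [Finset.sum_mul]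
  refine Finset.sum_congr rfl fun j _ => ?_
  rw [W, Real.rpow_add_natCast h1, Real.rpow_add_natCast h2]
  ring

lemma integral_eval_mul_eval_mul_W {α : ℝ} (hα : -1 < α) (f g : ℝ[X]) :
    IntegrableOn (fun z : ℝ × ℝ => f.eval z.1 * g.eval z.2 * W α z.1 z.2)
      (Set.Ioi (0 : ℝ) ×ˢ Set.Ioi (0 : ℝ)) ∧
    ∫ z in Set.Ioi (0 : ℝ) ×ˢ Set.Ioi (0 : ℝ), f.eval z.1 * g.eval z.2 * W α z.1 z.2 =
      ∑ i ∈ Finset.range (f.natDegree + 1), ∑ j ∈ Finset.range (g.natDegree + 1),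
        f.coeff i * g.coeff j *
          (Real.Gamma (α + i + 1) * Real.Gamma (α + j + 2) / (2 * α + 2 + i + j)) := by
  have hm : MeasurableSet (Set.Ioi (0 : ℝ) ×ˢ Set.Ioi (0 : ℝ)) :=
    measurableSet_Ioi.prod measurableSet_Ioi
  have hb : ∀ i j : ℕ, _ := fun i j => by
    have hi : (0 : ℝ) ≤ i := i.cast_nonneg
    have hj : (0 : ℝ) ≤ j := j.cast_nonneg
    exact bimoment (a := α + i) (b := α + 1 + j) (by linarith) (by linarith) (by linarith)
  have hint : ∀ i ∈ Finset.range (f.natDegree + 1), ∀ j ∈ Finset.range (g.natDegree + 1),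
      IntegrableOn (fun z : ℝ × ℝ => f.coeff i * g.coeff j *
          (z.1 ^ (α + i) * z.2 ^ (α + 1 + j) * Real.exp (-z.1 - z.2) / (z.1 + z.2)))
        (Set.Ioi (0 : ℝ) ×ˢ Set.Ioi (0 : ℝ)) := fun i _ j _ => (hb i j).1.const_mul _
  constructor
  · refine IntegrableOn.congr_fun ?_ (fun z hz => (eval_mul_eval_mul_W f g hz).symm) hm
    exact integrable_finsetSum _ fun i hi => integrable_finsetSum _ fun j hj => hint i hi j hj
  · rw [setIntegral_congr_fun hm fun z hz => eval_mul_eval_mul_W f g hz,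
      integral_finsetSum _ fun i hi => integrable_finsetSum _ fun j hj => hint i hi j hj]
    refine Finset.sum_congr rfl fun i hi => ?_
    rw [integral_finsetSum _ fun j hj => hint i hi j hj]
    refine Finset.sum_congr rfl fun j _ => ?_
    rw [integral_const_mul, (hb i j).2, show α + 1 + j + 1 = α + j + 2 by ring,
      show α + i + (α + 1 + j) + 1 = 2 * α + 2 + i + j by ring]

/-! ### Orthogonality of the Jacobi coefficients -/

lemma fwdDiff_iter_apply_zero (f : ℝ → ℝ) (k : ℕ) :
    (fwdDiff (1 : ℝ))^[k] f 0 =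
      ∑ i ∈ Finset.range (k + 1), (-1) ^ (k - i) * (k.choose i : ℝ) * f i := by
  rw [fwdDiff_iter_eq_sum_shift]
  simp

lemma fwdDiff_iter_inv (k : ℕ) {t x : ℝ} (h : 0 < t + x) :
    (fwdDiff (1 : ℝ))^[k] (fun x => (t + x)⁻¹) x =
      (-1) ^ k * k.factorial / (ascPochhammer ℝ (k + 1)).eval (t + x) := by
  induction k generalizing x with
  | zero => simp
  | succ k ih =>
    rw [Function.iterate_succ_apply', fwdDiff, ih h, ih (by linarith)]
    have hl : (ascPochhammer ℝ (k + 1 + 1)).eval (t + x) =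
        (t + x) * (ascPochhammer ℝ (k + 1)).eval (t + (x + 1)) := by
      rw [ascPochhammer_succ_left, eval_mul, eval_X, eval_comp]
      simp [add_assoc]
    have hr := ascPochhammer_succ_eval (k + 1) (t + x)
    have h0 := (ascPochhammer_pos (k + 1) (t + x) h).ne'
    have h1 := (ascPochhammer_pos (k + 1) (t + (x + 1)) (by linarith)).ne'
    have h2 := (ascPochhammer_pos (k + 1 + 1) (t + x) h).ne'
    rw [Nat.factorial_succ]
    push_cast at hr ⊢
    rw [div_sub_div _ _ h1 h0, div_eq_div_iff (mul_ne_zero h1 h0) h2]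
    have hd : (t + x) * (ascPochhammer ℝ (k + 1)).eval (t + (x + 1)) =
        (ascPochhammer ℝ (k + 1)).eval (t + x) * (t + x + (k + 1)) := hl.symm.trans hr
    rw [hl]
    linear_combination (-1) ^ k * (k.factorial : ℝ) *
      (ascPochhammer ℝ (k + 1)).eval (t + (x + 1)) * (-hd)

/-- The shifted Pochhammer polynomial `(x + β) (x + β + 1) ⋯ (x + β + k - 1)`. -/
def shiftedPochhammer (β : ℝ) (k : ℕ) : ℝ[X] := (ascPochhammer ℝ k).comp (X + C β)

lemma natDegree_shiftedPochhammer (β : ℝ) (k : ℕ) : (shiftedPochhammer β k).natDegree = k := by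
  rw [shiftedPochhammer, natDegree_comp, ascPochhammer_natDegree, natDegree_X_add_C, mul_one]

lemma leadingCoeff_shiftedPochhammer (β : ℝ) (k : ℕ) :
    (shiftedPochhammer β k).leadingCoeff = 1 := by
  rw [shiftedPochhammer, leadingCoeff_comp (by simp), (monic_ascPochhammer ℝ k).leadingCoeff]
  simp

lemma eval_shiftedPochhammer (β x : ℝ) (k : ℕ) :
    (shiftedPochhammer β k).eval x = (ascPochhammer ℝ k).eval (x + β) := by
  simp [shiftedPochhammer]

lemma Gamma_add_natCast {x : ℝ} (hx : 0 < x) (k : ℕ) :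
    Real.Gamma (x + k) = (ascPochhammer ℝ k).eval x * Real.Gamma x := by
  induction k with
  | zero => simp
  | succ k ih =>
    rw [Gamma_succ (x := x + k) (by positivity) (by push_cast; ring), ih, ascPochhammer_succ_eval]
    ring

/-- The signed binomial makes a sum over row k a k-th finite difference at 0 of a monic polynomial
of degree k times the test function. -/
lemma jacobiCoeff_eq {β : ℝ} (hβ : 0 < β) {k i : ℕ} (h : i ≤ k) :
    jacobiCoeff β k i =
      (-1) ^ (k - i) * (k.choose i : ℝ) * (shiftedPochhammer β k).eval (i : ℝ) / k.factorial := by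
  obtain ⟨n, rfl⟩ := Nat.exists_eq_add_of_le h
  have hp : 0 < β + i := by positivity
  have hg := (Real.Gamma_pos_of_pos hp).ne'
  rw [jacobiCoeff_add, eval_shiftedPochhammer, Nat.add_sub_cancel_left,
    Nat.cast_choose ℝ (Nat.le_add_right i n), Nat.add_sub_cancel_left,
    show β + (2 * (i : ℝ) + n) = β + i + ((i + n : ℕ) : ℝ) by push_cast; ring,
    Gamma_add_natCast hp, add_comm (i : ℝ) β]
  field_simp

lemma sum_jacobiCoeff_mul {β : ℝ} (hβ : 0 < β) (k : ℕ) (h : ℝ → ℝ) :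
    ∑ i ∈ Finset.range (k + 1), jacobiCoeff β k i * h i =
      (fwdDiff (1 : ℝ))^[k] (fun x => (shiftedPochhammer β k).eval x * h x) 0 / k.factorial := by
  rw [fwdDiff_iter_apply_zero, Finset.sum_div]
  refine Finset.sum_congr rfl fun i hi => ?_
  rw [jacobiCoeff_eq hβ (Nat.lt_succ_iff.1 (Finset.mem_range.1 hi))]
  ring

lemma sum_range_jacobiCoeff {β : ℝ} (hβ : 0 < β) (k : ℕ) :
    ∑ i ∈ Finset.range (k + 1), jacobiCoeff β k i = 1 := by
  have h := sum_jacobiCoeff_mul hβ k fun _ => 1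
  simp only [mul_one] at h
  have hd := (shiftedPochhammer β k).fwdDiff_iter_degree_eq_factorial
  rw [natDegree_shiftedPochhammer, leadingCoeff_shiftedPochhammer, one_smul] at hd
  rw [h, show (fun x => (shiftedPochhammer β k).eval x) = (shiftedPochhammer β k).eval from rfl, hd]
  simp [Nat.factorial_ne_zero]

/-- Divide the shifted Pochhammer polynomial by X + β + j. The k-th difference kills the quotient,
which has degree below k; the remainder (-j)_k multiplies the difference of 1/(β+j+x). For j < k
that remainder is zero, which is the orthogonality. -/
lemma sum_jacobiCoeff_div {β : ℝ} (hβ : 0 < β) (k j : ℕ) :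
    ∑ i ∈ Finset.range (k + 1), jacobiCoeff β k i / (β + i + j) =
      (ascPochhammer ℝ k).eval (-(j : ℝ)) * (-1) ^ k /
        (ascPochhammer ℝ (k + 1)).eval (β + j) := by
  have hp : 0 < β + j := by positivity
  have hdiv := modByMonic_add_div (shiftedPochhammer β k) (X - C (-(β + j)))
  rw [modByMonic_X_sub_C_eq_C_eval, eval_shiftedPochhammer,
    show -(β + j) + β = -(j : ℝ) by ring] at hdiv
  set R := shiftedPochhammer β k /ₘ (X - C (-(β + j))) with hR
  set c := (ascPochhammer ℝ k).eval (-(j : ℝ)) with hc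
  have hR0 : (fwdDiff (1 : ℝ))^[k] R.eval 0 = 0 := by
    rcases k with _ | k
    · have : R = 0 := by
        rw [hR, shiftedPochhammer]
        simpa using (divByMonic_eq_zero_iff (monic_X_sub_C (-(β + (j : ℝ))))).2 (by
          rw [degree_X_sub_C]; simp)
      simp [this]
    · rw [fwdDiff_iter_eq_zero_of_degree_lt, Pi.zero_apply]
      rw [hR, natDegree_divByMonic _ (monic_X_sub_C _), natDegree_shiftedPochhammer,
        natDegree_X_sub_C]
      lia
  have hinv := fwdDiff_iter_inv k (t := β + j) (x := 0) (by simpa using hp)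
  rw [fwdDiff_iter_apply_zero] at hR0 hinv
  have hterm : ∀ i ∈ Finset.range (k + 1), jacobiCoeff β k i / (β + i + j) =
      (-1) ^ (k - i) * (k.choose i : ℝ) * R.eval (i : ℝ) / k.factorial +
        c / k.factorial * ((-1) ^ (k - i) * (k.choose i : ℝ) * (β + j + i)⁻¹) := by
    intro i hi
    have he : (shiftedPochhammer β k).eval (i : ℝ) = c + (β + j + i) * R.eval (i : ℝ) := by
      have := congrArg (eval (i : ℝ)) hdiv
      simp only [eval_add, eval_C, eval_mul, eval_sub, eval_X] at this
      rw [← this]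
      ring
    have hne : β + j + i ≠ 0 := by positivity
    rw [jacobiCoeff_eq hβ (Nat.lt_succ_iff.1 (Finset.mem_range.1 hi)), he,
      show β + i + j = β + j + i by ring]
    field_simp
    ring
  rw [Finset.sum_congr rfl hterm, Finset.sum_add_distrib, ← Finset.sum_div, hR0, ← Finset.mul_sum,
    hinv, add_zero]
  field_simp
  simp

lemma sum_jacobiCoeff_div_of_lt {β : ℝ} (hβ : 0 < β) {k j : ℕ} (h : j < k) :
    ∑ i ∈ Finset.range (k + 1), jacobiCoeff β k i / (β + i + j) = 0 := by
  rw [sum_jacobiCoeff_div hβ, ascPochhammer_eval_neg_coe_nat_of_lt h]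
  simp

lemma jacobiCoeff_self_mul_sum {β : ℝ} (hβ : 0 < β) (k : ℕ) :
    jacobiCoeff β k k * ∑ i ∈ Finset.range (k + 1), jacobiCoeff β k i / (β + i + k) =
      1 / (β + 2 * k) := by
  have hp : 0 < β + k := by positivity
  have h1 := (ascPochhammer_pos k (β + k) hp).ne'
  have h2 : β + k + k ≠ 0 := by positivity
  have hs : ((-1 : ℝ) ^ k) * (-1) ^ k = 1 := by rw [← mul_pow]; simp
  rw [sum_jacobiCoeff_div hβ, jacobiCoeff_eq hβ le_rfl, eval_shiftedPochhammer,
    ascPochhammer_eval_neg_eq_descPochhammer, descPochhammer_eval_eq_descFactorial,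
    Nat.descFactorial_self, ascPochhammer_succ_eval, add_comm (k : ℝ) β]
  simp only [Nat.sub_self, pow_zero, Nat.choose_self, Nat.cast_one, one_mul]
  have h3 : β + 2 * (k : ℝ) ≠ 0 := by positivity
  field_simp
  linear_combination (β + 2 * k) * hs

lemma sum_sum_jacobiCoeff {β : ℝ} (hβ : 0 < β) (k l : ℕ) :
    ∑ i ∈ Finset.range (k + 1), ∑ j ∈ Finset.range (l + 1),
      jacobiCoeff β k i * jacobiCoeff β l j / (β + i + j) =
        if k = l then 1 / (β + 2 * k) else 0 := by
  have key : ∀ {k l : ℕ}, l ≤ k → ∑ i ∈ Finset.range (k + 1), ∑ j ∈ Finset.range (l + 1),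
      jacobiCoeff β k i * jacobiCoeff β l j / (β + i + j) =
        if k = l then 1 / (β + 2 * k) else 0 := by
    intro k l hlk
    rw [Finset.sum_comm]
    have hz : ∀ j : ℕ, ∑ i ∈ Finset.range (k + 1),
        jacobiCoeff β k i * jacobiCoeff β l j / (β + i + j) = jacobiCoeff β l j *
          ∑ i ∈ Finset.range (k + 1), jacobiCoeff β k i / (β + i + j) := fun j => by
      rw [Finset.mul_sum]
      exact Finset.sum_congr rfl fun i _ => by ring
    simp_rw [hz]
    -- As l ≤ k, every j < l sums to zero over i; only j = l can survive, and only when l = k.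
    rw [Finset.sum_range_succ, Finset.sum_eq_zero, zero_add]
    · split_ifs with h
      · subst h
        exact jacobiCoeff_self_mul_sum hβ k
      · rw [sum_jacobiCoeff_div_of_lt hβ (lt_of_le_of_ne hlk (Ne.symm h)), mul_zero]
    · intro j hj
      rw [sum_jacobiCoeff_div_of_lt hβ ((Finset.mem_range.1 hj).trans_le hlk), mul_zero]
  rcases le_total l k with h | h
  · exact key h
  · rw [Finset.sum_comm]
    have hs : ∀ i j : ℕ, jacobiCoeff β k i * jacobiCoeff β l j / (β + i + j) =
        jacobiCoeff β l j * jacobiCoeff β k i / (β + j + i) := fun i j => by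
      rw [mul_comm, add_right_comm]
    simp_rw [hs]
    rw [key h]
    by_cases hkl : k = l
    · simp [hkl]
    · simp [hkl, Ne.symm hkl]

/-! ### Moments of p and q, and biorthonormality -/

lemma coeff_p_mul_Gamma {α : ℝ} (hα : -1 < α) (k i : ℕ) :
    (p α k).coeff i * Real.Gamma (α + i + 1) = √2 * jacobiCoeff (2 * α + 2) k i := by
  have hi : (0 : ℝ) ≤ i := i.cast_nonneg
  have := (Real.Gamma_pos_of_pos (show 0 < α + i + 1 by linarith)).ne'
  rw [coeff_p]
  field_simp

lemma coeff_q_mul_Gamma {α : ℝ} (hα : -1 < α) (k i : ℕ) :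
    (q α k).coeff i * Real.Gamma (α + i + 2) =
      √2 * (α + k + 1) * jacobiCoeff (2 * α + 2) k i := by
  have hi : (0 : ℝ) ≤ i := i.cast_nonneg
  have := (Real.Gamma_pos_of_pos (show 0 < α + i + 2 by linarith)).ne'
  rw [coeff_q]
  field_simp

lemma integral_weight_p {α : ℝ} (hα : -1 < α) (k : ℕ) :
    ∫ v in Set.Ioi (0 : ℝ), v ^ α * Real.exp (-v) * (p α k).eval v = √2 := by
  rw [integral_weight_mul_eval hα, natDegree_p hα,
    Finset.sum_congr rfl fun i _ => coeff_p_mul_Gamma hα k i, ← Finset.mul_sum,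
    sum_range_jacobiCoeff (by linarith), mul_one]

lemma integral_weight_q {α : ℝ} (hα : -1 < α) (k : ℕ) :
    ∫ v in Set.Ioi (0 : ℝ), v ^ (α + 1) * Real.exp (-v) * (q α k).eval v = √2 * (α + k + 1) := by
  rw [integral_weight_mul_eval (by linarith), natDegree_q hα]
  simp_rw [show ∀ i : ℕ, α + 1 + i + 1 = α + i + 2 from fun i => by ring]
  rw [Finset.sum_congr rfl fun i _ => coeff_q_mul_Gamma hα k i, ← Finset.mul_sum,
    sum_range_jacobiCoeff (by linarith), mul_one]

lemma isBiorthonormal {α : ℝ} (hα : -1 < α) : IsBiorthonormal α (p α) (q α) where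
  natDegree_left := natDegree_p hα
  natDegree_right := natDegree_q hα
  leadingCoeff_pos k := by
    rw [leadingCoeff, natDegree_p hα]
    exact coeff_p_pos hα k
  leadingCoeff_eq k := by
    rw [leadingCoeff, leadingCoeff, natDegree_p hα, natDegree_q hα, coeff_q_self hα]
  integrable k l := (integral_eval_mul_eval_mul_W hα _ _).1
  integral_eq k l := by
    rw [(integral_eval_mul_eval_mul_W hα _ _).2, natDegree_p hα, natDegree_q hα]
    have hterm : ∀ i j : ℕ, (p α k).coeff i * (q α l).coeff j *
        (Real.Gamma (α + i + 1) * Real.Gamma (α + j + 2) / (2 * α + 2 + i + j)) =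
        2 * (α + l + 1) * (jacobiCoeff (2 * α + 2) k i * jacobiCoeff (2 * α + 2) l j /
          (2 * α + 2 + i + j)) := fun i j => by
      have h2 : √2 * √2 = 2 := Real.mul_self_sqrt zero_le_two
      calc _ = ((p α k).coeff i * Real.Gamma (α + i + 1)) *
            ((q α l).coeff j * Real.Gamma (α + j + 2)) / (2 * α + 2 + i + j) := by ring
        _ = (√2 * √2) * (α + l + 1) * (jacobiCoeff (2 * α + 2) k i *
            jacobiCoeff (2 * α + 2) l j / (2 * α + 2 + i + j)) := by
          rw [coeff_p_mul_Gamma hα, coeff_q_mul_Gamma hα]; ring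
        _ = _ := by rw [h2]
    simp_rw [hterm, ← Finset.mul_sum]
    rw [sum_sum_jacobiCoeff (by linarith)]
    split_ifs with h
    · subst h
      have hk : (0 : ℝ) ≤ k := k.cast_nonneg
      have : α + k + 1 ≠ 0 := by linarith
      rw [show 2 * α + 2 + 2 * (k : ℝ) = 2 * (α + k + 1) by ring]
      field_simp
    · simp

end CauchyLaguerre

end

theorem proposition1 (α : ℝ) (hα : -1 < α) (m : ℕ) (hm : 1 ≤ m) :
    -- `p`, `q` are the biorthogonal polynomials, and their Cauchy transforms converge
    CauchyLaguerre.IsBiorthonormal α (CauchyLaguerre.p α) (CauchyLaguerre.q α) ∧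
    (∀ k : ℕ, ∀ x ∈ CauchyLaguerre.cauchyDomain α, IntegrableOn
      (CauchyLaguerre.cauchyIntegrand α (CauchyLaguerre.p α k) x) (Set.Ioi (0 : ℝ))) ∧
    (∀ k : ℕ, ∀ y ∈ CauchyLaguerre.cauchyDomain (α + 1), IntegrableOn
      (CauchyLaguerre.cauchyIntegrand (α + 1) (CauchyLaguerre.q α k) y) (Set.Ioi (0 : ℝ))) ∧
    -- the kernel of `p` and `q`
    (∀ x y : ℂ,
      (x + y) * ∑ k ∈ Finset.range m,
          aeval x (CauchyLaguerre.p α k) * aeval y (CauchyLaguerre.q α k) =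
        CauchyLaguerre.christoffelDarboux α m
          (fun k => aeval x (CauchyLaguerre.p α k)) (fun k => aeval y (CauchyLaguerre.q α k)) x y) ∧
    -- the kernel of `P` and `q`
    (∀ x ∈ CauchyLaguerre.cauchyDomain α, ∀ y : ℂ,
      (x + y) * ∑ k ∈ Finset.range m,
          CauchyLaguerre.P α k x * aeval y (CauchyLaguerre.q α k) =
        CauchyLaguerre.christoffelDarboux α m
          (fun k => CauchyLaguerre.P α k x) (fun k => aeval y (CauchyLaguerre.q α k)) x y) ∧
    -- the kernel of `p` and `Q`
    (∀ x : ℂ, ∀ y ∈ CauchyLaguerre.cauchyDomain (α + 1),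
      (x + y) * ∑ k ∈ Finset.range m,
          aeval x (CauchyLaguerre.p α k) * CauchyLaguerre.Q α k y =
        CauchyLaguerre.christoffelDarboux α m
          (fun k => aeval x (CauchyLaguerre.p α k)) (fun k => CauchyLaguerre.Q α k y) x y) ∧
    -- the kernel of `P` and `Q`
    (∀ x ∈ CauchyLaguerre.cauchyDomain α, ∀ y ∈ CauchyLaguerre.cauchyDomain (α + 1),
      (x + y) * ∑ k ∈ Finset.range m, CauchyLaguerre.P α k x * CauchyLaguerre.Q α k y =
        -1 + CauchyLaguerre.christoffelDarboux α m
          (fun k => CauchyLaguerre.P α k x) (fun k => CauchyLaguerre.Q α k y) x y) := by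
  have hα' : -1 < α + 1 := by linarith
  have h2 : (√2 : ℂ) * √2 = 2 := by
    rw [← Complex.ofReal_mul, Real.mul_self_sqrt zero_le_two, Complex.ofReal_ofNat]
  -- Evaluation commutes with multiplication by x, so its defect is zero.
  have hp : ∀ x : ℂ, ∀ m : ℕ, _ := fun x => CauchyLaguerre.map_p_recurrence hα
    (aeval x).toLinearMap x 0 fun m => by simp
  have hq : ∀ y : ℂ, ∀ m : ℕ, _ := fun y => CauchyLaguerre.map_q_recurrence hα
    (aeval y).toLinearMap y 0 fun m => by simp
  have hP : ∀ x (hx : x ∈ CauchyLaguerre.cauchyDomain α), ∀ m : ℕ, _ := fun x hx =>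
    CauchyLaguerre.map_p_recurrence hα (CauchyLaguerre.cauchyLinear hα hx) x √2 fun m => by
      rw [CauchyLaguerre.mul_cauchyLinear, CauchyLaguerre.integral_weight_p hα]
  -- The moment √2 (α+m+1) equals 2(α+m+1) · (√2/2), whence v = √2/2.
  have hQ : ∀ y (hy : y ∈ CauchyLaguerre.cauchyDomain (α + 1)), ∀ m : ℕ, _ := fun y hy =>
    CauchyLaguerre.map_q_recurrence hα (CauchyLaguerre.cauchyLinear hα' hy) y (√2 / 2) fun m => by
      rw [CauchyLaguerre.mul_cauchyLinear, CauchyLaguerre.integral_weight_q hα]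
      push_cast
      ring
  refine ⟨CauchyLaguerre.isBiorthonormal hα,
    fun k x hx => CauchyLaguerre.integrableOn_cauchyIntegrand hα _ hx,
    fun k y hy => CauchyLaguerre.integrableOn_cauchyIntegrand hα' _ hy,
    fun x y => ?_, fun x hx y => ?_, fun x y hy => ?_, fun x hx y hy => ?_⟩
  · refine (CauchyLaguerre.christoffelDarboux_of_recurrence hα _ _ x y 0 0 (hp x) (hq y) hm).trans ?_
    rw [mul_zero, neg_zero, zero_add]
    rfl
  · refine (CauchyLaguerre.christoffelDarboux_of_recurrence hα _ _ x y _ 0 (hP x hx) (hq y)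
      hm).trans ?_
    rw [mul_zero, neg_zero, zero_add]
    rfl
  · refine (CauchyLaguerre.christoffelDarboux_of_recurrence hα _ _ x y 0 _ (hp x) (hQ y hy)
      hm).trans ?_
    rw [zero_mul, neg_zero, zero_add]
    rfl
  · refine (CauchyLaguerre.christoffelDarboux_of_recurrence hα _ _ x y _ _ (hP x hx) (hQ y hy)
      hm).trans ?_
    rw [mul_div_assoc', h2, div_self two_ne_zero]
    rfl
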